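/- All Banach spaces are real, operators are bounded linear operators, $X^*$ is the dual space, and $\mathcal L(X,Y)$ is the set of all operators from $X$ to $Y$. A continuous quadratic form on a Banach space $X$ is a function $q\colon X\to\mathbb R$ of the form $q(x)=b(x,x)$ with $b\colon X\times X\to\mathbb R$ a continuous bilinear form. We say that $X$ has (D) if every continuous quadratic form on $X$ is a difference of two nonnegative continuous quadratic forms on $X$, and that $X$ has (dc) if every continuous quadratic form on $X$ is a difference of two continuous convex functions on $X$. An operator $T\colon X\to Y$ is factorizable through a Hilbert space if $T=BA$ for some operators $A\colon X\to H$ and $B\colon H\to Y$ with $H$ a Hilbert space. An $X$-valued Walsh–Paley martingale is a finite sequence $(f_0,\dots,f_n)$ of functions $f_k\colon\{-1,1\}^n\to X$ such that $f_k$ depends only on the first $k$ coordinates and $f_k(\omega)=\frac12 f_{k+1}(\omega,-1)+\frac12 f_{k+1}(\omega,1)$ for all $0\le k<n$ and $\omega\in\{-1,1\}^k$; put $df_k=f_k-f_{k-1}$ for $1\le k\le n$. An operator $T\colon X\to Y$ is a UMD-operator if there is a constant $C>0$ such that $$\mathbb E\Bigl\|\sum_{k=1}^n\varepsilon_k\,T\,df_k\Bigr\|^2\le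 C\,\mathbb E\|f_n\|^2$$ for every $X$-valued Walsh–Paley martingale $(f_0,\dots,f_n)$ of any length and all numbers $\varepsilon_1,\dots,\varepsilon_n\in\{-1,1\}$, where $\mathbb E$ is the expectation for the uniform probability on $\{-1,1\}^n$. **Corollary 3.6.** Let $X_1$ and $X_2$ be Banach spaces. Then: (a) $X_1\oplus X_2$ has (D) if and only if $X_1$ and $X_2$ have (D) and every element of $\mathcal L(X_1,X_2^*)$ is factorizable through a Hilbert space; (b) $X_1\oplus X_2$ has (dc) if and only if $X_1$ and $X_2$ have (dc) and every element of $\mathcal L(X_1,X_2^*)$ is a UMD-operator. In particular, if $X$ is a Banach space isomorphic to $X^2=X\oplus X$, then: (a') $X$ has (D) if and only if every element of $\mathcal L(X,X^*)$ is factorizable through a Hilbert space; (b') $X$ has (dc) if and only if every element of $\mathcal L(X,X^*)$ is a UMD-operator. -/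

import Mathlib

section QuadraticForms

variable {X : Type*} [NormedAddCommGroup X] [NormedSpace ℝ X]

/-- `q : X → ℝ` is a continuous (purely) quadratic form: `q x = b x x` for some continuous
bilinear form `b` on `X` (encoded, as usual, as a continuous linear map `X → X*`). -/
def IsContQuadForm (q : X → ℝ) : Prop :=
  ∃ b : X →L[ℝ] X →L[ℝ] ℝ, ∀ x, q x = b x x

/-- `q` is a difference of two nonnegative continuous quadratic forms. -/
def IsDeltaSemidefinite (q : X → ℝ) : Prop :=
  ∃ p₁ p₂ : X → ℝ, IsContQuadForm p₁ ∧ IsContQuadForm p₂ ∧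
    (∀ x, 0 ≤ p₁ x) ∧ (∀ x, 0 ≤ p₂ x) ∧ ∀ x, q x = p₁ x - p₂ x

/-- `φ` is a difference of two continuous convex functions on the whole space `X`. -/
def IsDeltaConvex (φ : X → ℝ) : Prop :=
  ∃ g h : X → ℝ, Continuous g ∧ Continuous h ∧
    ConvexOn ℝ Set.univ g ∧ ConvexOn ℝ Set.univ h ∧ ∀ x, φ x = g x - h x

variable (X) in
/-- Property (D): every continuous quadratic form on `X` is delta-semidefinite. -/
def PropertyD : Prop := ∀ q : X → ℝ, IsContQuadForm q → IsDeltaSemidefinite q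

variable (X) in
/-- Property (dc): every continuous quadratic form on `X` is delta-convex. -/
def PropertyDC : Prop := ∀ q : X → ℝ, IsContQuadForm q → IsDeltaConvex q

end QuadraticForms

/-- `T : X → Y` factors through a Hilbert space: `T = B A` with bounded operators `A : X → H`,
`B : H → Y` and a real Hilbert space `H`. The universe of `H` is no restriction, since `H` may
always be replaced by the closure of the range of `A`. -/
def FactorsThroughHilbert.{u, v} {X : Type u} {Y : Type v}
    [NormedAddCommGroup X] [NormedSpace ℝ X] [NormedAddCommGroup Y] [NormedSpace ℝ Y]
    (T : X →L[ℝ] Y) : Prop :=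
  ∃ (H : Type (max u v)) (_ : NormedAddCommGroup H) (_ : InnerProductSpace ℝ H)
    (_ : CompleteSpace H) (A : X →L[ℝ] H) (B : H →L[ℝ] Y), T = B.comp A

/-- `(f 0, …, f n)` is an `X`-valued Walsh-Paley martingale on `{-1, 1}ⁿ` (here `{-1, 1} = ℤˣ`):
`f k` depends on the first `k` coordinates only, and its value is the mean of the two values of
`f (k + 1)` at the two possible values of the next coordinate (which has index `k` in `Fin n`). -/
structure IsWalshPaleyMartingale {X : Type*} [NormedAddCommGroup X] [NormedSpace ℝ X] {n : ℕ}
    (f : Fin (n + 1) → (Fin n → ℤˣ) → X) : Prop where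
  adapted : ∀ (k : Fin (n + 1)) (ω ω' : Fin n → ℤˣ),
    (∀ i : Fin n, (i : ℕ) < (k : ℕ) → ω i = ω' i) → f k ω = f k ω'
  average : ∀ (k : Fin n) (ω : Fin n → ℤˣ),
    f k.castSucc ω = (1 / 2 : ℝ) • f k.succ (Function.update ω k (-1)) +
      (1 / 2 : ℝ) • f k.succ (Function.update ω k 1)

/-- Expectation with respect to the uniform probability measure on `{-1, 1}ⁿ`. -/
noncomputable def cubeExpectation {n : ℕ} (g : (Fin n → ℤˣ) → ℝ) : ℝ :=
  ((2 : ℝ) ^ n)⁻¹ * ∑ ω : Fin n → ℤˣ, g ω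

/-- `T` is a UMD-operator: there is `C > 0` with `𝔼 ‖∑ₖ εₖ T(dfₖ)‖² ≤ C 𝔼 ‖fₙ‖²` for all
Walsh-Paley martingales `(f₀, …, fₙ)` and all signs `εₖ`; the difference `dfₖ = fₖ - fₖ₋₁` is
indexed here by `Fin n`, as `f k.succ - f k.castSucc`. -/
def IsUMDOperator {X Y : Type*}
    [NormedAddCommGroup X] [NormedSpace ℝ X] [NormedAddCommGroup Y] [NormedSpace ℝ Y]
    (T : X →L[ℝ] Y) : Prop :=
  ∃ C : ℝ, 0 < C ∧ ∀ (n : ℕ) (f : Fin (n + 1) → (Fin n → ℤˣ) → X), IsWalshPaleyMartingale f →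
    ∀ ε : Fin n → ℤˣ,
      cubeExpectation (fun ω => ‖∑ k : Fin n, ε k • T (f k.succ ω - f k.castSucc ω)‖ ^ 2) ≤
        C * cubeExpectation (fun ω => ‖f (Fin.last n) ω‖ ^ 2)

/-! A symmetrised quadratic form on a product splits into two forms on the factors and a mixed form
`T x y`, so both equivalences reduce to mixed forms; restricting forms to complemented subspaces
gives the rest.

For (D), a positive semidefinite form is the pullback of a Hilbert inner product. Polarising a
difference of two such forms factors `T` through the sum of two Hilbert spaces. Conversely, a
factorization turns the form into an inner product of two operators, which is a difference of
squares.

For (dc), the link is the estimate `𝔼 ∑ |q (dfₖ)| ≤ K 𝔼 ‖fₙ‖²` with `q x = b x x`. If `b` is UMD,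
pairing `fₙ` with its transform by the signs of `q (dfₖ)` yields the estimate
(`exists_variation_le`). From the estimate, a Bellman-type infimum `V` over martingales makes `V`
and `V + q` convex and continuous (`IsUMDOperator.isDeltaConvex`). If `q = g - h` with `g`, `h`
convex, then `g + h` controls `|q|`; rescaling it along the growth of the martingale and applying
Doob's inequality recovers the estimate (`variation_add_le`, `maxSq_le`). For symmetric `b`, duality
and polarisation lead from the estimate back to UMD (`isUMDOperator_of_isDeltaConvex`). A mixed form
is brought to the symmetric case on the product space. -/

/-! ### Semidefinite forms and Hilbert space factorizations -/

section Hilbert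

open InnerProductSpace

/-- Every positive semidefinite symmetric bilinear form is the pullback of the inner product of a
Hilbert space. -/
theorem LinearMap.exists_hilbert_inner_eq.{u} {F : Type u} [AddCommGroup F] [Module ℝ F]
    (s : F →ₗ[ℝ] F →ₗ[ℝ] ℝ) (hsymm : ∀ x y, s x y = s y x) (hnonneg : ∀ x, 0 ≤ s x x) :
    ∃ (H : Type u) (_ : NormedAddCommGroup H) (_ : InnerProductSpace ℝ H) (_ : CompleteSpace H)
      (A : F →ₗ[ℝ] H), ∀ x y, inner ℝ (A x) (A y) = s x y := by
  let core : PreInnerProductSpace.Core ℝ F :=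
    { inner := fun x y => s x y
      conj_inner_symm := fun x y => by simpa using hsymm y x
      re_inner_nonneg := fun x => by simpa using hnonneg x
      add_left := fun x y z => by simp
      smul_left := fun x y r => by simp }
  let : SeminormedAddCommGroup F :=
    @InnerProductSpace.Core.toSeminormedAddCommGroup ℝ F _ _ _ core
  let : InnerProductSpace ℝ F := InnerProductSpace.ofCore core
  -- The completion is Hausdorff, so it also divides out the kernel of the seminorm.
  exact ⟨UniformSpace.Completion F, inferInstance, inferInstance, inferInstance,
    (UniformSpace.Completion.toComplₗᵢ (𝕜 := ℝ) (E := F)).toLinearMap,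
    fun x y => UniformSpace.Completion.inner_coe (𝕜 := ℝ) x y⟩

/-- Every positive semidefinite symmetric continuous bilinear form is the pullback of the inner
product of a Hilbert space under a bounded operator. -/
theorem exists_hilbert_inner_eq.{u} {X : Type u} [NormedAddCommGroup X] [NormedSpace ℝ X]
    (s : X →L[ℝ] X →L[ℝ] ℝ) (hsymm : ∀ x y, s x y = s y x) (hnonneg : ∀ x, 0 ≤ s x x) :
    ∃ (H : Type u) (_ : NormedAddCommGroup H) (_ : InnerProductSpace ℝ H) (_ : CompleteSpace H)
      (A : X →L[ℝ] H), ∀ x y, inner ℝ (A x) (A y) = s x y := by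
  obtain ⟨H, i₁, i₂, i₃, A, hA⟩ := LinearMap.exists_hilbert_inner_eq s.toLinearMap₁₂ hsymm hnonneg
  replace hA : ∀ x y, inner ℝ (A x) (A y) = s x y := hA
  refine ⟨H, i₁, i₂, i₃, A.mkContinuous (√‖s‖) fun x => ?_, fun x y => hA x y⟩
  have h : ‖A x‖ ^ 2 ≤ (√‖s‖ * ‖x‖) ^ 2 := by
    rw [mul_pow, Real.sq_sqrt (norm_nonneg s), ← real_inner_self_eq_norm_sq, hA]
    calc s x x ≤ ‖s x x‖ := Real.le_norm_self _
      _ ≤ ‖s‖ * ‖x‖ * ‖x‖ := s.le_opNorm₂ x x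
      _ = ‖s‖ * ‖x‖ ^ 2 := by ring
  exact le_of_sq_le_sq h (by positivity)

variable {X Y : Type*} [NormedAddCommGroup X] [NormedSpace ℝ X]
  [NormedAddCommGroup Y] [NormedSpace ℝ Y]

theorem IsContQuadForm.comp {q : Y → ℝ} (hq : IsContQuadForm q) (L : X →L[ℝ] Y) :
    IsContQuadForm (fun x => q (L x)) := by
  obtain ⟨b, hb⟩ := hq
  exact ⟨b.bilinearComp L L, fun x => by simp [hb]⟩

theorem IsContQuadForm.add {p q : X → ℝ} (hp : IsContQuadForm p) (hq : IsContQuadForm q) :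
    IsContQuadForm (fun x => p x + q x) := by
  obtain ⟨b, hb⟩ := hp
  obtain ⟨c, hc⟩ := hq
  exact ⟨b + c, fun x => by simp [hb, hc]⟩

theorem IsContQuadForm.exists_symm {q : X → ℝ} (hq : IsContQuadForm q) :
    ∃ s : X →L[ℝ] X →L[ℝ] ℝ, (∀ x y, s x y = s y x) ∧ ∀ x, q x = s x x := by
  obtain ⟨b, hb⟩ := hq
  refine ⟨(1 / 2 : ℝ) • (b + b.flip), fun x y => ?_, fun x => ?_⟩
  · simp only [smul_apply, add_apply,
      ContinuousLinearMap.flip_apply, smul_eq_mul]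
    ring
  · simp only [smul_apply, add_apply,
      ContinuousLinearMap.flip_apply, smul_eq_mul, hb]
    ring

theorem IsDeltaSemidefinite.comp {q : Y → ℝ} (hq : IsDeltaSemidefinite q) (L : X →L[ℝ] Y) :
    IsDeltaSemidefinite (fun x => q (L x)) := by
  obtain ⟨p₁, p₂, h₁, h₂, n₁, n₂, h⟩ := hq
  exact ⟨_, _, h₁.comp L, h₂.comp L, fun x => n₁ _, fun x => n₂ _, fun x => h _⟩

theorem IsDeltaSemidefinite.add {p q : X → ℝ} (hp : IsDeltaSemidefinite p)
    (hq : IsDeltaSemidefinite q) : IsDeltaSemidefinite (fun x => p x + q x) := by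
  obtain ⟨p₁, p₂, h₁, h₂, n₁, n₂, h⟩ := hp
  obtain ⟨q₁, q₂, h₁', h₂', n₁', n₂', h'⟩ := hq
  exact ⟨_, _, h₁.add h₁', h₂.add h₂', fun x => add_nonneg (n₁ x) (n₁' x),
    fun x => add_nonneg (n₂ x) (n₂' x), fun x => by simp only [h, h']; ring⟩

theorem isContQuadForm_norm_sq {H : Type*} [NormedAddCommGroup H] [InnerProductSpace ℝ H]
    (L : X →L[ℝ] H) (c : ℝ) : IsContQuadForm (fun x => c * ‖L x‖ ^ 2) :=
  ⟨c • (innerSL ℝ (E := H)).bilinearComp L L, fun x => by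
    simp [ContinuousLinearMap.bilinearComp_apply]⟩

/-- The quadratic form of an operator that factors through a Hilbert space is
delta-semidefinite. -/
theorem isDeltaSemidefinite_of_factor {H : Type*} [NormedAddCommGroup H] [InnerProductSpace ℝ H]
    [CompleteSpace H] (A : X →L[ℝ] H) (B : H →L[ℝ] X →L[ℝ] ℝ) :
    IsDeltaSemidefinite (fun x => B (A x) x) := by
  -- By Riesz, `B (A x) x` is the inner product of `B' x` and `A x`, and polarisation applies.
  let B' : X →L[ℝ] H :=
    ((toDual ℝ H).symm.toContinuousLinearEquiv.toContinuousLinearMap).comp B.flip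
  have hB' : ∀ h x, inner ℝ (B' x) h = B h x := fun h x => by simp [B']
  refine ⟨_, _, isContQuadForm_norm_sq (A + B') (1 / 4), isContQuadForm_norm_sq (A - B') (1 / 4),
    fun x => by positivity, fun x => by positivity, fun x => ?_⟩
  simp only [add_apply, sub_apply]
  rw [norm_add_sq_real, norm_sub_sq_real, ← hB', real_inner_comm]
  ring

/-- If the form `(x, y) ↦ T x y` is delta-semidefinite, then `T` factors through a Hilbert
space. -/
theorem FactorsThroughHilbert.of_isDeltaSemidefinite {T : X →L[ℝ] Y →L[ℝ] ℝ}
    (h : IsDeltaSemidefinite (fun z : X × Y => T z.1 z.2)) : FactorsThroughHilbert T := by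
  obtain ⟨p₁, p₂, h₁, h₂, n₁, n₂, hT⟩ := h
  obtain ⟨s₁, symm₁, hs₁⟩ := h₁.exists_symm
  obtain ⟨s₂, symm₂, hs₂⟩ := h₂.exists_symm
  obtain ⟨H₁, i₁, j₁, k₁, A₁, hA₁⟩ :=
    exists_hilbert_inner_eq s₁ symm₁ (fun x => hs₁ x ▸ n₁ x)
  obtain ⟨H₂, i₂, j₂, k₂, A₂, hA₂⟩ :=
    exists_hilbert_inner_eq s₂ symm₂ (fun x => hs₂ x ▸ n₂ x)
  let inl := ContinuousLinearMap.inl ℝ X Y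
  let inr := ContinuousLinearMap.inr ℝ X Y
  -- The minus sign carries `p₁ - p₂`; the factor 2 counts the two equal cross terms of each
  -- symmetric form.
  let B : (H₁ × H₂) →L[ℝ] Y →L[ℝ] ℝ := (2 : ℝ) •
    ((innerSL ℝ (E := H₁)).bilinearComp (.fst ℝ H₁ H₂) (A₁.comp inr) -
      (innerSL ℝ (E := H₂)).bilinearComp (.snd ℝ H₁ H₂) (A₂.comp inr))
  let e := WithLp.prodContinuousLinearEquiv 2 ℝ H₁ H₂
  refine ⟨WithLp 2 (H₁ × H₂), inferInstance, inferInstance, inferInstance,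
    e.symm.toContinuousLinearMap.comp ((A₁.comp inl).prod (A₂.comp inl)),
    B.comp e.toContinuousLinearMap, ?_⟩
  ext x y
  have key : T x y = 2 * (s₁ (inl x) (inr y) - s₂ (inl x) (inr y)) := by
    have e₁ := hT (inl x + inr y)
    have e₂ := hT (inl x)
    have e₃ := hT (inr y)
    rw [hs₁, hs₂] at e₁ e₂ e₃
    simp only [map_add, add_apply, symm₁ (inr y), symm₂ (inr y)] at e₁
    simp only [inl, inr, ContinuousLinearMap.inl_apply, ContinuousLinearMap.inr_apply,
      Prod.fst_add, Prod.snd_add, add_zero, zero_add, map_zero,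
      zero_apply] at e₁ e₂ e₃ ⊢
    linarith
  simp [B, hA₁, hA₂, key]

end Hilbert

/-! ### Property (D) on products -/

section PropertyD

variable {X Y : Type*} [NormedAddCommGroup X] [NormedSpace ℝ X]
  [NormedAddCommGroup Y] [NormedSpace ℝ Y]

theorem PropertyD.of_leftInverse (h : PropertyD Y) (i : X →L[ℝ] Y) (p : Y →L[ℝ] X)
    (hpi : ∀ x, p (i x) = x) : PropertyD X := fun q hq => by
  have := (h _ (hq.comp p)).comp i
  simpa only [hpi] using this

/-- A form on `X` is already `b x x` for an operator `b` from `X` to its dual, so this direction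
needs no splitting of `X`. -/
theorem propertyD_of_factors (h : ∀ T : X →L[ℝ] (X →L[ℝ] ℝ), FactorsThroughHilbert T) :
    PropertyD X := fun q ⟨b, hb⟩ => by
  obtain ⟨H, i₁, i₂, i₃, A, B, hT⟩ := h b
  rw [funext hb, hT]
  exact isDeltaSemidefinite_of_factor A B

theorem isContQuadForm_mixed (T : X →L[ℝ] Y →L[ℝ] ℝ) :
    IsContQuadForm (fun z : X × Y => T z.1 z.2) :=
  ⟨T.bilinearComp (.fst ℝ X Y) (.snd ℝ X Y), fun z => by simp⟩

theorem IsContQuadForm.exists_prod_decomp {q : X × Y → ℝ} (hq : IsContQuadForm q) :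
    ∃ T : X →L[ℝ] Y →L[ℝ] ℝ, ∀ z, q z = (q (z.1, 0) + q (0, z.2)) + T z.1 z.2 := by
  obtain ⟨s, hs, h⟩ := hq.exists_symm
  refine ⟨(2 : ℝ) • s.bilinearComp (.inl ℝ X Y) (.inr ℝ X Y), fun z => ?_⟩
  have hz : z = (z.1, 0) + (0, z.2) := by simp
  rw [h, h, h]
  conv_lhs => rw [hz]
  simp only [map_add, add_apply, smul_apply,
    ContinuousLinearMap.bilinearComp_apply, ContinuousLinearMap.inl_apply,
    ContinuousLinearMap.inr_apply, smul_eq_mul, hs (0, z.2) (z.1, 0)]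
  ring

theorem propertyD_prod_iff : PropertyD (X × Y) ↔
    (PropertyD X ∧ PropertyD Y ∧ ∀ T : X →L[ℝ] (Y →L[ℝ] ℝ), FactorsThroughHilbert T) := by
  constructor
  · intro h
    exact ⟨h.of_leftInverse (.inl ℝ X Y) (.fst ℝ X Y) fun x => by simp,
      h.of_leftInverse (.inr ℝ X Y) (.snd ℝ X Y) fun x => by simp,
      fun T => .of_isDeltaSemidefinite (h _ (isContQuadForm_mixed T))⟩
  · rintro ⟨h₁, h₂, h⟩ q hq
    obtain ⟨T, hT⟩ := hq.exists_prod_decomp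
    obtain ⟨H, i₁, i₂, i₃, A, B, rfl⟩ := h T
    rw [funext hT]
    refine .add (.add ?_ ?_) ?_
    · exact (h₁ _ (hq.comp (.inl ℝ X Y))).comp (.fst ℝ X Y)
    · exact (h₂ _ (hq.comp (.inr ℝ X Y))).comp (.snd ℝ X Y)
    · exact isDeltaSemidefinite_of_factor (A.comp (.fst ℝ X Y))
        (B.bilinearComp (.id ℝ H) (.snd ℝ X Y))

end PropertyD

/-! ### Expectation on the discrete cube -/

section CubeExpectation

theorem cubeExpectation_zero (g : (Fin 0 → ℤˣ) → ℝ) : cubeExpectation g = g ![] := by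
  simp [cubeExpectation, Matrix.empty_eq]

theorem cubeExpectation_succ {n : ℕ} (g : (Fin (n + 1) → ℤˣ) → ℝ) :
    cubeExpectation g = 1 / 2 * (cubeExpectation (fun ω => g (Fin.cons (-1) ω)) +
      cubeExpectation (fun ω => g (Fin.cons 1 ω))) := by
  have hu : (Finset.univ : Finset ℤˣ) = {-1, 1} := by decide
  have h : ∑ ω, g ω = ∑ s : ℤˣ, ∑ ω : Fin n → ℤˣ, g (Fin.cons s ω) := by
    rw [← Fintype.sum_prod_type']
    exact (Fintype.sum_equiv (Fin.consEquiv fun _ => ℤˣ) _ _ fun _ => rfl).symm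
  rw [hu, Finset.sum_pair (by decide)] at h
  simp only [cubeExpectation, h, pow_succ]
  field_simp

theorem cubeExpectation_mono {n : ℕ} {g h : (Fin n → ℤˣ) → ℝ} (H : ∀ ω, g ω ≤ h ω) :
    cubeExpectation g ≤ cubeExpectation h :=
  mul_le_mul_of_nonneg_left (Finset.sum_le_sum fun ω _ => H ω) (by positivity)

theorem cubeExpectation_add {n : ℕ} (g h : (Fin n → ℤˣ) → ℝ) :
    cubeExpectation (fun ω => g ω + h ω) = cubeExpectation g + cubeExpectation h := by
  simp only [cubeExpectation, Finset.sum_add_distrib, mul_add]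

theorem cubeExpectation_const_mul {n : ℕ} (c : ℝ) (g : (Fin n → ℤˣ) → ℝ) :
    cubeExpectation (fun ω => c * g ω) = c * cubeExpectation g := by
  simp only [cubeExpectation, ← Finset.mul_sum]
  ring

theorem cubeExpectation_const {n : ℕ} (c : ℝ) :
    cubeExpectation (fun _ : Fin n → ℤˣ => c) = c := by
  simp [cubeExpectation]

end CubeExpectation

/-! ### Walsh–Paley martingales, cut and glued at the first step -/

namespace IsWalshPaleyMartingale

variable {X Y : Type*} [NormedAddCommGroup X] [NormedSpace ℝ X]
  [NormedAddCommGroup Y] [NormedSpace ℝ Y] {n : ℕ}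

theorem const (n : ℕ) (x : X) :
    IsWalshPaleyMartingale (fun (_ : Fin (n + 1)) (_ : Fin n → ℤˣ) => x) where
  adapted _ _ _ _ := rfl
  average _ _ := by rw [← add_smul]; norm_num

theorem map {f : Fin (n + 1) → (Fin n → ℤˣ) → X} (hf : IsWalshPaleyMartingale f)
    (L : X →L[ℝ] Y) : IsWalshPaleyMartingale (fun k ω => L (f k ω)) where
  adapted k ω ω' h := by rw [hf.adapted k ω ω' h]
  average k ω := by rw [hf.average k ω]; simp

theorem add_smul {f g : Fin (n + 1) → (Fin n → ℤˣ) → X} (hf : IsWalshPaleyMartingale f)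
    (hg : IsWalshPaleyMartingale g) (c : ℝ) :
    IsWalshPaleyMartingale (fun k ω => f k ω + c • g k ω) where
  adapted k ω ω' h := by rw [hf.adapted k ω ω' h, hg.adapted k ω ω' h]
  average k ω := by rw [hf.average k ω, hg.average k ω]; module

/-- The part of a Walsh-Paley martingale after its first step. -/
theorem tail {f : Fin (n + 2) → (Fin (n + 1) → ℤˣ) → X} (hf : IsWalshPaleyMartingale f)
    (s : ℤˣ) : IsWalshPaleyMartingale
      (fun (k : Fin (n + 1)) (ω : Fin n → ℤˣ) => f k.succ (Fin.cons s ω)) where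
  adapted k ω ω' h := hf.adapted _ _ _ fun i => by
    refine Fin.cases ?_ (fun j => ?_) i
    · simp
    · intro hj
      simpa using h j (by simpa using hj)
  average k ω := by
    have := hf.average k.succ (Fin.cons s ω)
    simpa only [← Fin.cons_update, ← Fin.succ_castSucc] using this

/-- Glue two Walsh-Paley martingales that start at `x - d` and `x + d`. -/
theorem glue {f : ℤˣ → Fin (n + 1) → (Fin n → ℤˣ) → X}
    (hf : ∀ s, IsWalshPaleyMartingale (f s)) {x d : X} (h₀ : ∀ ω, f (-1) 0 ω = x - d)
    (h₁ : ∀ ω, f 1 0 ω = x + d) : IsWalshPaleyMartingale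
      (fun (k : Fin (n + 2)) (ω : Fin (n + 1) → ℤˣ) =>
        Fin.cases (motive := fun _ => X) x (fun j => f (ω 0) j (Fin.tail ω)) k) where
  adapted k ω ω' h := by
    revert h
    refine Fin.cases (fun _ => rfl) (fun j h => ?_) k
    simp only [Fin.cases_succ]
    rw [h 0 (by simp)]
    exact (hf _).adapted _ _ _ fun i hi => h i.succ (by simpa using hi)
  average k ω := by
    refine Fin.cases ?_ (fun j => ?_) k
    · simp only [Fin.castSucc_zero, Fin.cases_zero, Fin.cases_succ, Function.update_self, h₀, h₁]
      module
    · rw [← Fin.succ_castSucc]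
      simp only [Fin.cases_succ, Fin.tail_update_succ]
      rw [Function.update_of_ne (Fin.succ_ne_zero j).symm,
        Function.update_of_ne (Fin.succ_ne_zero j).symm]
      exact (hf _).average j _

theorem exists_step {f : Fin (n + 2) → (Fin (n + 1) → ℤˣ) → X} (hf : IsWalshPaleyMartingale f)
    {x : X} (hx : ∀ ω, f 0 ω = x) : ∃ d : X,
      (∀ ω : Fin n → ℤˣ, f (Fin.succ 0) (Fin.cons (-1) ω) = x - d) ∧
      (∀ ω : Fin n → ℤˣ, f (Fin.succ 0) (Fin.cons 1 ω) = x + d) := by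
  have hc : ∀ (s : ℤˣ) (ω ω' : Fin n → ℤˣ),
      f (Fin.succ 0) (Fin.cons s ω) = f (Fin.succ 0) (Fin.cons s ω') := fun s ω ω' =>
    (hf.tail s).adapted 0 ω ω' (by simp)
  have hav := hf.average 0 (Fin.cons 1 fun _ => 1)
  rw [Fin.castSucc_zero, hx, Fin.update_cons_zero, Fin.update_cons_zero] at hav
  refine ⟨f (Fin.succ 0) (Fin.cons 1 fun _ => 1) - x, fun ω => ?_, fun ω => ?_⟩
  · rw [hc _ ω fun _ => 1]
    rw [hav]
    module
  · rw [hc _ ω fun _ => 1]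
    abel

theorem exists_initial {f : Fin (n + 1) → (Fin n → ℤˣ) → X} (hf : IsWalshPaleyMartingale f) :
    ∃ x, ∀ ω, f 0 ω = x :=
  ⟨f 0 fun _ => 1, fun ω => hf.adapted 0 _ _ (by simp)⟩

/-- Every function on the cube is the last term of a Walsh-Paley martingale. -/
theorem exists_last_eq (n : ℕ) (g : (Fin n → ℤˣ) → X) :
    ∃ f : Fin (n + 1) → (Fin n → ℤˣ) → X, IsWalshPaleyMartingale f ∧ f (Fin.last n) = g := by
  induction n with
  | zero =>
    refine ⟨fun _ => g, ⟨fun _ ω ω' _ => by rw [Subsingleton.elim ω ω'], fun k => k.elim0⟩, rfl⟩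
  | succ n ih =>
    choose f hf hfg using fun s : ℤˣ => ih fun ω => g (Fin.cons s ω)
    obtain ⟨a, ha⟩ := (hf (-1)).exists_initial
    obtain ⟨b, hb⟩ := (hf 1).exists_initial
    refine ⟨_, glue hf (x := (1 / 2 : ℝ) • a + (1 / 2 : ℝ) • b)
      (d := (1 / 2 : ℝ) • b - (1 / 2 : ℝ) • a) (fun ω => ?_) (fun ω => ?_), ?_⟩
    · rw [ha]; module
    · rw [hb]; module
    · funext ω
      rw [← Fin.succ_last]
      simp only [Fin.cases_succ, hfg, Fin.cons_self_tail]

end IsWalshPaleyMartingale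

/-! ### Dyadic trees as a recursive model of martingales -/

/-- Binary trees labelled by the increments `d` of a dyadic martingale: from `x`, the martingale
moves to `x - d` (left) or `x + d` (right). -/
inductive DyadicTree (X : Type*)
  | leaf : DyadicTree X
  | node (d : X) (l r : DyadicTree X) : DyadicTree X

namespace DyadicTree

section Expectation

variable {X Y : Type*} [NormedAddCommGroup X] [NormedAddCommGroup Y]

/-- The expectation of `F` at the final position of the martingale that starts at `x`. -/
noncomputable def expect (F : X → ℝ) : DyadicTree X → X → ℝ
  | leaf, x => F x
  | node d l r, x => 1 / 2 * (expect F l (x - d) + expect F r (x + d))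

/-- The expectation of `∑ |q dₖ|`. -/
noncomputable def variation (q : X → ℝ) : DyadicTree X → ℝ
  | leaf => 0
  | node d l r => |q d| + 1 / 2 * (variation q l + variation q r)

/-- The number of steps. -/
def depth : DyadicTree X → ℕ
  | leaf => 0
  | node _ l r => max l.depth r.depth + 1

/-- The martingale together with its transform with the multipliers `v k d`. -/
def transform (T : X → Y) : (ℕ → X → ℤˣ) → DyadicTree X → DyadicTree (X × Y)
  | _, leaf => leaf
  | v, node d l r => node (d, v 0 d • T d) (transform T (fun k => v (k + 1)) l)
      (transform T (fun k => v (k + 1)) r)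

theorem expect_mono {F G : X → ℝ} (h : ∀ x, F x ≤ G x) (t : DyadicTree X) (x : X) :
    expect F t x ≤ expect G t x := by
  induction t generalizing x with
  | leaf => exact h x
  | node d l r ihl ihr =>
    simp only [expect]
    linarith [ihl (x - d), ihr (x + d)]

theorem expect_linear (a b : ℝ) (F G : X → ℝ) (t : DyadicTree X) (x : X) :
    expect (fun x => a * F x + b * G x) t x = a * expect F t x + b * expect G t x := by
  induction t generalizing x with
  | leaf => rfl
  | node d l r ihl ihr =>
    simp only [expect, ihl, ihr]
    ring

theorem expect_transform_fst (F : X → ℝ) (T : X → Y) (v : ℕ → X → ℤˣ) (t : DyadicTree X)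
    (x : X) (y : Y) : expect (fun z => F z.1) (transform T v t) (x, y) = expect F t x := by
  induction t generalizing v x y with
  | leaf => rfl
  | node d l r ihl ihr => simp [transform, expect, ihl, ihr]

end Expectation

variable {X Y : Type*} [NormedAddCommGroup X] [NormedSpace ℝ X]
  [NormedAddCommGroup Y] [NormedSpace ℝ Y]

/-- A tree and level signs are realized by a Walsh-Paley martingale. -/
theorem exists_martingale (T : X →L[ℝ] Y) (n : ℕ) (t : DyadicTree X) (ht : t.depth ≤ n)
    (ε : ℕ → ℤˣ) (x : X) : ∃ f : Fin (n + 1) → (Fin n → ℤˣ) → X, IsWalshPaleyMartingale f ∧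
      (∀ ω, f 0 ω = x) ∧ ∀ (F : X × Y → ℝ) (y : Y),
        cubeExpectation (fun ω => F (f (Fin.last n) ω,
          y + ∑ k : Fin n, ε k • T (f k.succ ω - f k.castSucc ω))) =
        expect F (transform T (fun k _ => ε k) t) (x, y) := by
  induction n generalizing t ε x with
  | zero =>
    cases t with
    | leaf =>
      exact ⟨_, .const 0 x, fun _ => rfl, fun F y => by
        simp [cubeExpectation_zero, transform, expect]⟩
    | node d l r => simp [depth] at ht
  | succ n ih =>
    cases t with
    | leaf =>
      exact ⟨_, .const (n + 1) x, fun _ => rfl, fun F y => by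
        simp [cubeExpectation_const, transform, expect]⟩
    | node d l r =>
      simp only [depth, add_le_add_iff_right, max_le_iff] at ht
      obtain ⟨f₀, hf₀, i₀, e₀⟩ := ih l ht.1 (fun k => ε (k + 1)) (x - d)
      obtain ⟨f₁, hf₁, i₁, e₁⟩ := ih r ht.2 (fun k => ε (k + 1)) (x + d)
      let f : ℤˣ → Fin (n + 1) → (Fin n → ℤˣ) → X := fun s => if s = 1 then f₁ else f₀
      have hfm : f (-1) = f₀ := if_neg (by decide)
      have hfp : f 1 = f₁ := if_pos rfl
      refine ⟨_, IsWalshPaleyMartingale.glue (f := f) (x := x) (d := d) (fun s => ?_)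
        (by rwa [hfm]) (by rwa [hfp]), fun _ => rfl, fun F y => ?_⟩
      · rcases Int.units_eq_one_or s with rfl | rfl
        · rwa [hfp]
        · rwa [hfm]
      · rw [cubeExpectation_succ]
        simp only [← Fin.succ_last, Fin.cases_succ, Fin.cons_zero, Fin.tail_cons, hfm, hfp,
          Fin.sum_univ_succ, Fin.castSucc_zero, Fin.cases_zero, ← Fin.succ_castSucc, i₀, i₁,
          Fin.val_zero, Fin.val_succ, ← add_assoc, e₀, e₁]
        simp only [transform, expect, Prod.mk_sub_mk, Prod.mk_add_mk]
        simp [sub_eq_add_neg]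

/-- A Walsh-Paley martingale is described by a tree. -/
theorem exists_of_martingale {n : ℕ} {f : Fin (n + 1) → (Fin n → ℤˣ) → X}
    (hf : IsWalshPaleyMartingale f) {x : X} (hx : ∀ ω, f 0 ω = x) : ∃ t : DyadicTree X,
      (∀ F : X → ℝ, cubeExpectation (fun ω => F (f (Fin.last n) ω)) = expect F t x) ∧
      ∀ q : X → ℝ, (∀ d, q (-d) = q d) →
        cubeExpectation (fun ω => ∑ k : Fin n, |q (f k.succ ω - f k.castSucc ω)|) =
          variation q t := by
  induction n generalizing x with
  | zero =>
    refine ⟨leaf, fun F => ?_, fun q _ => ?_⟩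
    · simp only [cubeExpectation_zero, expect]
      rw [← hx ![]]
      rfl
    · simp [cubeExpectation_zero, variation]
  | succ n ih =>
    obtain ⟨d, h₀, h₁⟩ := hf.exists_step hx
    obtain ⟨l, el, vl⟩ := ih (hf.tail (-1)) h₀
    obtain ⟨r, er, vr⟩ := ih (hf.tail 1) h₁
    refine ⟨node d l r, fun F => ?_, fun q hq => ?_⟩
    · rw [cubeExpectation_succ, expect, ← el, ← er]
      rfl
    · rw [cubeExpectation_succ, variation, ← vl q hq, ← vr q hq]
      simp only [Fin.sum_univ_succ (n := n), Fin.castSucc_zero, hx, h₀, h₁,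
        cubeExpectation_add, cubeExpectation_const, ← Fin.succ_castSucc, sub_sub_cancel_left,
        add_sub_cancel_left, hq]
      ring

end DyadicTree

/-- Orthogonality of martingale differences. -/
theorem IsWalshPaleyMartingale.expectation_pairing {X : Type*} [NormedAddCommGroup X]
    [NormedSpace ℝ X] (b : X →L[ℝ] X →L[ℝ] ℝ) {n : ℕ} {f g : Fin (n + 1) → (Fin n → ℤˣ) → X}
    (hf : IsWalshPaleyMartingale f) (hg : IsWalshPaleyMartingale g) (ε : Fin n → ℤˣ)
    (y : X →L[ℝ] ℝ) {u : X} (hu : ∀ ω, g 0 ω = u) :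
    cubeExpectation (fun ω =>
      (y + ∑ k : Fin n, ε k • b (f k.succ ω - f k.castSucc ω)) (g (Fin.last n) ω)) =
    y u + cubeExpectation (fun ω => ∑ k : Fin n,
      (ε k • b (f k.succ ω - f k.castSucc ω)) (g k.succ ω - g k.castSucc ω)) := by
  induction n generalizing y u with
  | zero =>
    simp only [cubeExpectation_zero, Finset.univ_eq_empty, Finset.sum_empty, add_zero]
    rw [← hu ![]]
    rfl
  | succ n ih =>
    obtain ⟨x, hx⟩ := hf.exists_initial
    obtain ⟨d, f₀, f₁⟩ := hf.exists_step hx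
    obtain ⟨e, g₀, g₁⟩ := hg.exists_step hu
    have i₀ := fun y => ih (hf.tail (-1)) (hg.tail (-1)) (fun k => ε k.succ) y g₀
    have i₁ := fun y => ih (hf.tail 1) (hg.tail 1) (fun k => ε k.succ) y g₁
    rw [cubeExpectation_succ, cubeExpectation_succ]
    simp only [Fin.sum_univ_succ (n := n), Fin.castSucc_zero, hx, hu, f₀, f₁, g₀, g₁,
      cubeExpectation_add, cubeExpectation_const, ← Fin.succ_castSucc, sub_sub_cancel_left,
      add_sub_cancel_left, ← add_assoc, ← Fin.succ_last, i₀, i₁]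
    simp only [map_neg, smul_neg, add_apply, neg_apply, map_add, map_sub]
    ring

/-! ### Midpoint convexity with a quadratic upper bound -/

section MidpointConvex

variable {X : Type*} [NormedAddCommGroup X] [NormedSpace ℝ X]

/-- A midpoint convex function on the line that is bounded above on `[0, 1]` and vanishes at `0`
and `1` is nonpositive on `[0, 1]`. -/
theorem nonpos_of_midpoint_convex {h : ℝ → ℝ} {M : ℝ}
    (hmid : ∀ t s, h t ≤ 1 / 2 * (h (t - s) + h (t + s))) (h₀ : h 0 = 0) (h₁ : h 1 = 0)
    (hM : ∀ t ∈ Set.Icc (0 : ℝ) 1, h t ≤ M) : ∀ t ∈ Set.Icc (0 : ℝ) 1, h t ≤ 0 := by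
  -- Viewing `t` as the midpoint of its nearer endpoint, where `h` vanishes, and another point of
  -- the interval halves the bound.
  have key : ∀ n : ℕ, ∀ t ∈ Set.Icc (0 : ℝ) 1, h t ≤ M * (1 / 2) ^ n := by
    intro n
    induction n with
    | zero => simpa using hM
    | succ n ih =>
      rintro t ⟨ht₀, ht₁⟩
      rcases le_total t (1 / 2) with ht | ht
      · have e := hmid t t
        rw [sub_self, h₀] at e
        have := ih (t + t) ⟨by linarith, by linarith⟩
        rw [pow_succ]
        linarith
      · have e := hmid t (1 - t)
        rw [add_sub_cancel, h₁] at e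
        have := ih (t - (1 - t)) ⟨by linarith, by linarith⟩
        rw [pow_succ]
        linarith
  intro t ht
  refine ge_of_tendsto' (x := Filter.atTop) (f := fun n : ℕ => M * (1 / 2) ^ n) ?_
    fun n => key n t ht
  simpa using (tendsto_pow_atTop_nhds_zero_of_lt_one (r := (1 / 2 : ℝ)) (by norm_num)
    (by norm_num)).const_mul M

/-- The quadratic bound makes `g` bounded above on segments and near `0`: the former upgrades
midpoint convexity to convexity, the latter gives continuity. -/
theorem convexOn_continuous_of_midpoint_convex {g : X → ℝ} {K : ℝ} (hK : 0 ≤ K)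
    (hmid : ∀ x d, g x ≤ 1 / 2 * (g (x - d) + g (x + d))) (hg : ∀ x, g x ≤ K * ‖x‖ ^ 2) :
    ConvexOn ℝ Set.univ g ∧ Continuous g := by
  have hconv : ConvexOn ℝ Set.univ g := by
    refine ⟨convex_univ, fun x _ y _ a b ha hb hab => ?_⟩
    have key := nonpos_of_midpoint_convex
      (h := fun t => g (x + t • (y - x)) - ((1 - t) * g x + t * g y))
      (M := K * (‖x‖ + ‖y - x‖) ^ 2 + |g x| + |g y|) (fun t s => ?_) (by simp) (by simp)
      (fun t ht => ?_) b ⟨hb, by linarith⟩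
    · have hx : x + b • (y - x) = a • x + b • y := by
        rw [← eq_sub_iff_add_eq] at hab
        rw [hab]
        module
      rw [hx, ← hab] at key
      simp only [smul_eq_mul]
      linarith [key]
    · have := hmid (x + t • (y - x)) (s • (y - x))
      rw [show x + t • (y - x) - s • (y - x) = x + (t - s) • (y - x) by module,
        show x + t • (y - x) + s • (y - x) = x + (t + s) • (y - x) by module] at this
      linarith
    · have hn : ‖x + t • (y - x)‖ ≤ ‖x‖ + ‖y - x‖ := by
        refine (norm_add_le _ _).trans (add_le_add_right ?_ _)
        rw [norm_smul, Real.norm_of_nonneg ht.1]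
        exact mul_le_of_le_one_left (norm_nonneg _) ht.2
      have h₁ : g (x + t • (y - x)) ≤ K * (‖x‖ + ‖y - x‖) ^ 2 := (hg _).trans (by gcongr)
      have h₂ : -((1 - t) * g x) ≤ |g x| := by
        have := mul_le_mul_of_nonneg_left (neg_abs_le (g x)) (sub_nonneg.2 ht.2)
        nlinarith [mul_nonneg ht.1 (abs_nonneg (g x))]
      have h₃ : -(t * g y) ≤ |g y| := by
        have := mul_le_mul_of_nonneg_left (neg_abs_le (g y)) ht.1
        nlinarith [mul_nonneg (sub_nonneg.2 ht.2) (abs_nonneg (g y))]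
      linarith
  refine ⟨hconv, continuousOn_univ.1 ?_⟩
  refine ((hconv.continuousOn_tfae isOpen_univ Set.univ_nonempty).out 3 1).1 ?_
  refine ⟨0, trivial, K, ?_⟩
  rw [Filter.eventually_map]
  filter_upwards [Metric.ball_mem_nhds (0 : X) one_pos] with x hx
  rw [mem_ball_zero_iff] at hx
  refine (hg x).trans (mul_le_of_le_one_right hK ?_)
  exact pow_le_one₀ (norm_nonneg x) hx.le

end MidpointConvex

/-! ### From UMD to delta-convexity -/

section UMD

variable {X Y Z W : Type*} [NormedAddCommGroup X] [NormedSpace ℝ X]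
  [NormedAddCommGroup Y] [NormedSpace ℝ Y] [NormedAddCommGroup Z] [NormedSpace ℝ Z]
  [NormedAddCommGroup W] [NormedSpace ℝ W]

theorem IsUMDOperator.comp {T : Y →L[ℝ] Z} (hT : IsUMDOperator T) (L : Z →L[ℝ] W)
    (R : X →L[ℝ] Y) : IsUMDOperator (L.comp (T.comp R)) := by
  obtain ⟨C, hC, h⟩ := hT
  -- The summand 1 keeps the constant positive when `L` or `R` is zero.
  refine ⟨(‖L‖ ^ 2 * C * ‖R‖ ^ 2) + 1, by positivity, fun n f hf ε => ?_⟩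
  have e : ∀ ω, ‖∑ k : Fin n, ε k • L.comp (T.comp R) (f k.succ ω - f k.castSucc ω)‖ ^ 2 ≤
      ‖L‖ ^ 2 * ‖∑ k : Fin n, ε k • T (R (f k.succ ω) - R (f k.castSucc ω))‖ ^ 2 := fun ω => by
    rw [← mul_pow]
    refine pow_le_pow_left₀ (norm_nonneg _) ?_ 2
    refine le_of_eq_of_le (congrArg _ ?_) (L.le_opNorm _)
    simp [map_sum, Units.smul_def]
  have e' : ∀ ω, ‖R (f (Fin.last n) ω)‖ ^ 2 ≤ ‖R‖ ^ 2 * ‖f (Fin.last n) ω‖ ^ 2 := fun ω => by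
    rw [← mul_pow]
    exact pow_le_pow_left₀ (norm_nonneg _) (R.le_opNorm _) 2
  have hE : 0 ≤ cubeExpectation (fun ω => ‖f (Fin.last n) ω‖ ^ 2) :=
    mul_nonneg (by positivity) (Finset.sum_nonneg fun _ _ => by positivity)
  have h₁ := cubeExpectation_mono e
  have h₂ := h n _ (hf.map R) ε
  have h₃ := cubeExpectation_mono e'
  rw [cubeExpectation_const_mul] at h₁ h₃
  calc _ ≤ _ := h₁
    _ ≤ ‖L‖ ^ 2 * (C * (‖R‖ ^ 2 * cubeExpectation (fun ω => ‖f (Fin.last n) ω‖ ^ 2))) := by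
      gcongr
      exact h₂.trans (by gcongr)
    _ ≤ _ := by linarith

namespace DyadicTree

/-- Every step is doubled: the first half step moves if `σ d = 1`, the second one if not. -/
def double (σ : X → ℤˣ) : DyadicTree X → DyadicTree X
  | leaf => leaf
  | node d l r =>
    if σ d = 1 then
      node d (node 0 (double σ l) (double σ l)) (node 0 (double σ r) (double σ r))
    else node 0 (node d (double σ l) (double σ r)) (node d (double σ l) (double σ r))

/-- Predictable signs can be replaced by alternating ones. -/
theorem expect_transform_double (T : X →L[ℝ] Y) (σ : X → ℤˣ) (F : X × Y → ℝ)
    (t : DyadicTree X) (x : X) (y : Y) :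
    expect F (transform T (fun k _ => (-1) ^ k) (double σ t)) (x, y) =
      expect F (transform T (fun _ => σ) t) (x, y) := by
  have hshift : (fun (k : ℕ) (_ : X) => (-1 : ℤˣ) ^ (k + 1 + 1)) = fun k _ => (-1) ^ k := by
    funext k _
    simp [pow_succ]
  induction t generalizing x y with
  | leaf => rfl
  | node d l r ihl ihr =>
    rcases Int.units_eq_one_or (σ d) with h | h
    · simp only [double, h, if_true, transform, hshift, expect, Prod.mk_sub_mk, Prod.mk_add_mk,
        ihl, ihr]
      simp
      ring
    · have h' : σ d ≠ 1 := by rw [h]; decide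
      simp only [double, if_neg h', transform, hshift, expect, Prod.mk_sub_mk, Prod.mk_add_mk,
        ihl, ihr]
      simp [h]
      ring

/-- The two branches of a node cancel the terms linear in `d`, leaving only `(σ d • b d) d`. The
initial functional `y` is arbitrary so that the induction can pass to the children. -/
theorem expect_pairing (b : X →L[ℝ] X →L[ℝ] ℝ) {σ : X → ℤˣ}
    (hσ : ∀ d, (σ d • b d) d = |b d d|) (t : DyadicTree X) (x : X) (y : X →L[ℝ] ℝ) :
    expect (fun z => z.2 z.1) (transform b (fun _ => σ) t) (x, y) =
      y x + variation (fun d => b d d) t := by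
  induction t generalizing x y with
  | leaf => simp [transform, expect, variation]
  | node d l r ihl ihr =>
    simp only [transform, expect, variation, Prod.mk_sub_mk, Prod.mk_add_mk, ihl, ihr, ← hσ,
      map_add, map_sub, add_apply, sub_apply]
    ring

/-- Choosing the sign of `b d d` at each node turns the variation into a pairing of the martingale
with its transform, bounded by half the sum of the two squared norms. These signs vary from node to
node, whereas UMD allows one sign per level; `double` removes the discrepancy. -/
theorem exists_variation_le {b : X →L[ℝ] X →L[ℝ] ℝ} (hb : IsUMDOperator b) :
    ∃ K, 0 ≤ K ∧ ∀ t x, variation (fun d => b d d) t ≤ K * expect (fun x => ‖x‖ ^ 2) t x := by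
  obtain ⟨C, hC, h⟩ := hb
  refine ⟨(C + 1) / 2, by positivity, fun t x => ?_⟩
  let σ : X → ℤˣ := fun d => if 0 ≤ b d d then 1 else -1
  have hσ : ∀ d, (σ d • b d) d = |b d d| := fun d => by
    by_cases hd : 0 ≤ b d d
    · simp [σ, hd, abs_of_nonneg hd]
    · simp [σ, hd, abs_of_neg (not_le.1 hd)]
  have hp := expect_pairing b hσ t x 0
  rw [zero_apply, zero_add] at hp
  have hle : ∀ z : X × (X →L[ℝ] ℝ), z.2 z.1 ≤ 1 / 2 * ‖z.2‖ ^ 2 + 1 / 2 * ‖z.1‖ ^ 2 := fun z => by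
    have h₁ := (Real.le_norm_self _).trans (z.2.le_opNorm z.1)
    nlinarith [sq_nonneg (‖z.2‖ - ‖z.1‖)]
  have h₁ := expect_mono hle (transform b (fun _ => σ) t) (x, 0)
  rw [hp, expect_linear, expect_transform_fst (fun x => ‖x‖ ^ 2)] at h₁
  obtain ⟨f, hf, -, e⟩ := exists_martingale b _ (double σ t) le_rfl (fun k => (-1) ^ k) x
  have h₂ := h _ f hf fun k => (-1) ^ (k : ℕ)
  have e₁ := e (fun z => ‖z.2‖ ^ 2) 0
  have e₂ := e (fun z => ‖z.1‖ ^ 2) 0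
  rw [expect_transform_double] at e₁ e₂
  rw [expect_transform_fst (fun x => ‖x‖ ^ 2)] at e₂
  simp only [zero_add] at e₁
  rw [e₁, e₂] at h₂
  linarith

end DyadicTree

open DyadicTree in
/-- The quadratic form of a UMD-operator is delta-convex. -/
theorem IsUMDOperator.isDeltaConvex {b : X →L[ℝ] X →L[ℝ] ℝ} (hb : IsUMDOperator b) :
    IsDeltaConvex (fun x => b x x) := by
  obtain ⟨K, hK, h⟩ := exists_variation_le hb
  let q : X → ℝ := fun x => b x x
  let J : X → DyadicTree X → ℝ := fun x t => K * expect (fun x => ‖x‖ ^ 2) t x - variation q t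
  have hJ : ∀ x t, 0 ≤ J x t := fun x t => sub_nonneg.2 (h t x)
  -- The estimate says exactly that every `J x t` is nonnegative, so this infimum is finite.
  let V : X → ℝ := fun x => ⨅ t, J x t
  have : Nonempty (DyadicTree X) := ⟨leaf⟩
  have hV : ∀ x t, V x ≤ J x t := fun x t =>
    ciInf_le ⟨0, by rintro _ ⟨t, rfl⟩; exact hJ x t⟩ t
  have hVle : ∀ x, V x ≤ K * ‖x‖ ^ 2 := fun x => by simpa [J, expect, variation] using hV x leaf
  -- Trees at `x - d` and `x + d` can be grafted onto a root with increment `d`; the infima over the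
  -- two subtrees are taken independently.
  have hnode : ∀ x d, V x + |q d| ≤ 1 / 2 * (V (x - d) + V (x + d)) := fun x d => by
    have h₁ : ∀ l r, 2 * (V x + |q d|) ≤ J (x - d) l + J (x + d) r := fun l r => by
      have := hV x (node d l r)
      simp only [J, expect, variation] at this ⊢
      linarith
    have h₂ : ∀ r, 2 * (V x + |q d|) - J (x + d) r ≤ V (x - d) := fun r =>
      le_ciInf fun l => by linarith [h₁ l r]
    have h₃ : 2 * (V x + |q d|) - V (x - d) ≤ V (x + d) :=
      le_ciInf fun r => by linarith [h₂ r]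
    linarith
  have hpar : ∀ x d, q (x - d) + q (x + d) = 2 * (q x + q d) := fun x d => by
    simp only [q, map_add, map_sub, add_apply, sub_apply]
    ring
  have hq : ∀ x, q x ≤ ‖b‖ * ‖x‖ ^ 2 := fun x => by
    have := (Real.le_norm_self _).trans (b.le_opNorm₂ x x)
    simp only [q]
    linarith
  have c₁ := convexOn_continuous_of_midpoint_convex (g := V) hK
    (fun x d => by linarith [hnode x d, abs_nonneg (q d)]) hVle
  have c₂ := convexOn_continuous_of_midpoint_convex (g := fun x => V x + q x) (K := K + ‖b‖)
    (by positivity) (fun x d => by linarith [hnode x d, neg_abs_le (q d), hpar x d])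
    (fun x => by linarith [hVle x, hq x])
  exact ⟨_, _, c₂.2, c₁.2, c₂.1, c₁.1, fun x => by simp [q]⟩

end UMD

/-! ### From delta-convexity to the variation estimate -/

namespace DyadicTree

variable {X : Type*} [NormedAddCommGroup X]

/-- The expected square of the larger of `m` and twice the maximal value of `‖x‖ + ‖d‖`. -/
noncomputable def maxSq : ℝ → DyadicTree X → X → ℝ
  | m, leaf, _ => m ^ 2
  | m, node d l r, x => 1 / 2 * (maxSq (max m (2 * (‖x‖ + ‖d‖))) l (x - d) +
      maxSq (max m (2 * (‖x‖ + ‖d‖))) r (x + d))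

theorem maxSq_mono {m m' : ℝ} (hm : 0 ≤ m) (h : m ≤ m') (t : DyadicTree X) (x : X) :
    maxSq m t x ≤ maxSq m' t x := by
  induction t generalizing m m' x with
  | leaf => exact pow_le_pow_left₀ hm h 2
  | node d l r ihl ihr =>
    have h₁ : max m (2 * (‖x‖ + ‖d‖)) ≤ max m' (2 * (‖x‖ + ‖d‖)) := max_le_max_right _ h
    have h₀ : 0 ≤ max m (2 * (‖x‖ + ‖d‖)) := hm.trans (le_max_left _ _)
    simp only [maxSq]
    linarith [ihl h₀ h₁ (x - d), ihr h₀ h₁ (x + d)]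

/-- Here `ψ R` controls the convexity of `q` and is of size `M R ^ 2` on the ball of radius `R`. -/
theorem variation_add_le {q : X → ℝ} {ψ : ℝ → X → ℝ} {M : ℝ}
    (hψ : ∀ R, 0 < R → ∀ x d, ψ R x + |q d| ≤ 1 / 2 * (ψ R (x - d) + ψ R (x + d)))
    (hM : ∀ R, 0 < R → ∀ x, ‖x‖ ≤ R → |ψ R x| ≤ M * R ^ 2) (t : DyadicTree X) {R : ℝ}
    (hR : 0 < R) {x : X} (hx : ‖x‖ ≤ R) :
    variation q t + ψ R x ≤ 3 * M * maxSq R t x - 2 * M * R ^ 2 := by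
  have hM₀ : 0 ≤ M := by simpa using (abs_nonneg _).trans (hM 1 one_pos 0 (by simp))
  induction t generalizing R x with
  | leaf =>
    simp only [variation, maxSq]
    linarith [le_abs_self (ψ R x), hM R hR x hx]
  | node d l r ihl ihr =>
    have step : ∀ R', 0 < R' → ‖x‖ + ‖d‖ ≤ R' → variation q (node d l r) + ψ R' x ≤
        3 * M * (1 / 2 * (maxSq R' l (x - d) + maxSq R' r (x + d))) - 2 * M * R' ^ 2 := by
      intro R' hR' hxd
      have i₀ := ihl hR' ((norm_sub_le x d).trans hxd)
      have i₁ := ihr hR' ((norm_add_le x d).trans hxd)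
      simp only [variation]
      linarith [hψ R' hR' x d]
    simp only [maxSq]
    rcases le_or_gt (‖x‖ + ‖d‖) R with h | h
    · refine (step R hR h).trans ?_
      have := maxSq_mono hR.le (le_max_left R (2 * (‖x‖ + ‖d‖))) l (x - d)
      have := maxSq_mono hR.le (le_max_left R (2 * (‖x‖ + ‖d‖))) r (x + d)
      gcongr
    -- Leaving the ball at least doubles the radius, so the reserve `2 * M * N ^ 2` pays for
    -- replacing `ψ N x` by `ψ R x` and still leaves `2 * M * R ^ 2`.
    · set N := 2 * (‖x‖ + ‖d‖) with hN
      have hNR : 2 * R ≤ N := by linarith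
      rw [max_eq_right (by linarith : R ≤ N)]
      have h₁ := step N (by linarith) (by linarith)
      have h₂ := (abs_le.1 (hM N (by linarith) x (by linarith))).1
      have h₃ := (abs_le.1 (hM R hR x hx)).2
      have h₄ : M * (2 * R) ^ 2 ≤ M * N ^ 2 := by gcongr
      nlinarith [mul_nonneg hM₀ (sq_nonneg R)]

variable [NormedSpace ℝ X]

/-- Doob's maximal inequality. -/
theorem maxSq_le {m μ : ℝ} (hm : 0 ≤ m) (hμ : m ≤ μ) (t : DyadicTree X) (x : X)
    (hx : 6 * ‖x‖ ≤ μ) :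
    maxSq m t x ≤ 144 * expect (fun x => ‖x‖ ^ 2) t x + 2 * μ ^ 2 - 24 * μ * ‖x‖ := by
  -- Here `μ` dominates six times the running maximum of the norm. At a leaf the claim follows from
  -- `(μ - 12 * ‖x‖) ^ 2 ≥ 0`.
  induction t generalizing m μ x with
  | leaf =>
    simp only [maxSq, expect]
    nlinarith [pow_le_pow_left₀ hm hμ 2, sq_nonneg (μ - 12 * ‖x‖)]
  | node d l r ihl ihr =>
    -- The factor 6 gives `2 * (‖x‖ + ‖d‖) ≤ 4 * ‖x‖ + 2 * ‖x'‖ ≤ max μ (6 * ‖x'‖)`. Raising `μ` to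
    -- `6 * ‖x'‖` does not increase `2 * μ ^ 2 - 24 * μ * ‖x'‖`, since that is its minimiser in `μ`.
    have step : ∀ x' : X, ‖d‖ ≤ ‖x‖ + ‖x'‖ →
        max m (2 * (‖x‖ + ‖d‖)) ≤ max μ (6 * ‖x'‖) ∧
        2 * max μ (6 * ‖x'‖) ^ 2 - 24 * max μ (6 * ‖x'‖) * ‖x'‖ ≤
          2 * μ ^ 2 - 24 * μ * ‖x'‖ := fun x' hd => by
      have a₁ := le_max_left μ (6 * ‖x'‖)
      have a₂ := le_max_right μ (6 * ‖x'‖)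
      refine ⟨max_le (hμ.trans a₁) (by linarith), ?_⟩
      rcases le_total (6 * ‖x'‖) μ with h | h
      · rw [max_eq_left h]
      · rw [max_eq_right h]
        nlinarith [sq_nonneg (μ - 6 * ‖x'‖)]
    have hd₀ : ‖d‖ ≤ ‖x‖ + ‖x - d‖ := by simpa using norm_sub_le x (x - d)
    have hd₁ : ‖d‖ ≤ ‖x‖ + ‖x + d‖ := by
      have := norm_sub_le (x + d) x
      rw [add_sub_cancel_left] at this
      linarith
    have h0 : 0 ≤ max m (2 * (‖x‖ + ‖d‖)) := hm.trans (le_max_left _ _)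
    obtain ⟨p₀, s₀⟩ := step _ hd₀
    obtain ⟨p₁, s₁⟩ := step _ hd₁
    have i₀ := ihl h0 p₀ (x - d) (le_max_right _ _)
    have i₁ := ihr h0 p₁ (x + d) (le_max_right _ _)
    have hn : 2 * ‖x‖ ≤ ‖x - d‖ + ‖x + d‖ := by
      have := norm_add_le (x - d) (x + d)
      rwa [show x - d + (x + d) = (2 : ℝ) • x by module, norm_smul, Real.norm_two] at this
    have hn' := mul_le_mul_of_nonneg_left hn (hm.trans hμ)
    simp only [maxSq, expect]
    linarith

/-- Start the radius at `6 * ‖x‖ + δ` and let `δ` tend to `0`; the shift keeps the radius positive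
when `x = 0`. The constant is 3 from the telescoping times 144 from Doob. -/
theorem variation_le_of_control {q : X → ℝ} {ψ : ℝ → X → ℝ} {M : ℝ}
    (hψ : ∀ R, 0 < R → ∀ x d, ψ R x + |q d| ≤ 1 / 2 * (ψ R (x - d) + ψ R (x + d)))
    (hM : ∀ R, 0 < R → ∀ x, ‖x‖ ≤ R → |ψ R x| ≤ M * R ^ 2) (t : DyadicTree X) (x : X) :
    variation q t ≤ 432 * M * expect (fun x => ‖x‖ ^ 2) t x := by
  have hM₀ : 0 ≤ M := by simpa using (abs_nonneg _).trans (hM 1 one_pos 0 (by simp))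
  have key : ∀ δ : ℝ, 0 < δ → variation q t ≤
      432 * M * expect (fun x => ‖x‖ ^ 2) t x + 5 * M * (6 * ‖x‖ + δ) * δ := fun δ hδ => by
    have hR : 0 < 6 * ‖x‖ + δ := by positivity
    have hxR : ‖x‖ ≤ 6 * ‖x‖ + δ := by linarith [norm_nonneg x]
    have h₁ := variation_add_le hψ hM t hR hxR
    have h₂ := mul_le_mul_of_nonneg_left
      (maxSq_le hR.le le_rfl t x (by linarith)) (by positivity : 0 ≤ 3 * M)
    have h₃ := (abs_le.1 (hM _ hR x hxR)).1
    have h₄ : 0 ≤ M * (6 * ‖x‖ + δ) * ‖x‖ := by positivity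
    nlinarith
  have ht : Filter.Tendsto (fun δ : ℝ => 432 * M * expect (fun x => ‖x‖ ^ 2) t x +
      5 * M * (6 * ‖x‖ + δ) * δ) (nhdsWithin 0 (Set.Ioi 0))
      (nhds (432 * M * expect (fun x => ‖x‖ ^ 2) t x)) := by
    have : Continuous fun δ : ℝ => 432 * M * expect (fun x => ‖x‖ ^ 2) t x +
      5 * M * (6 * ‖x‖ + δ) * δ := by fun_prop
    simpa using (this.tendsto 0).mono_left nhdsWithin_le_nhds
  exact ge_of_tendsto ht (eventually_nhdsWithin_of_forall fun δ hδ => key δ hδ)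

theorem exists_variation_le_of_isDeltaConvex {b : X →L[ℝ] X →L[ℝ] ℝ}
    (hb : IsDeltaConvex (fun x => b x x)) : ∃ K, 0 < K ∧ ∀ t x,
      variation (fun d => b d d) t ≤ K * expect (fun x => ‖x‖ ^ 2) t x := by
  obtain ⟨g, h, hg, hh, cg, ch, e⟩ := hb
  have hmid : ∀ {f : X → ℝ}, ConvexOn ℝ Set.univ f → ∀ x d : X,
      f x ≤ 1 / 2 * (f (x - d) + f (x + d)) := fun {f} hf x d => by
    have := hf.2 (Set.mem_univ (x - d)) (Set.mem_univ (x + d)) (by norm_num : (0 : ℝ) ≤ 1 / 2)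
      (by norm_num : (0 : ℝ) ≤ 1 / 2) (by norm_num)
    rw [show (1 / 2 : ℝ) • (x - d) + (1 / 2 : ℝ) • (x + d) = x by module] at this
    simpa only [smul_eq_mul, mul_add] using this
  -- The second difference of `g - h` is that of `q`, namely `b d d` after halving. Those of `g` and
  -- `h` are nonnegative, so that of their sum is at least `|b d d|`.
  let φ : X → ℝ := fun x => g x + h x
  have hφ : ∀ x d, φ x + |b d d| ≤ 1 / 2 * (φ (x - d) + φ (x + d)) := fun x d => by
    have e₀ := e x
    have e₁ := e (x - d)
    have e₂ := e (x + d)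
    have m₁ := hmid cg x d
    have m₂ := hmid ch x d
    simp only [map_add, map_sub, add_apply, sub_apply] at e₁ e₂
    rcases abs_cases (b d d) with ⟨ha, -⟩ | ⟨ha, -⟩ <;> rw [ha] <;> simp only [φ] <;> linarith
  have hcont : Continuous φ := hg.add hh
  obtain ⟨r, hr, hball⟩ := Metric.continuous_iff.1 hcont 0 1 one_pos
  let s := r / 2
  have hs : 0 < s := half_pos hr
  have hbd : ∀ x, ‖x‖ ≤ s → |φ x| ≤ |φ 0| + 1 := fun x hx => by
    have h₁ := hball x (by rw [dist_zero_right]; exact hx.trans_lt (half_lt_self hr))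
    rw [Real.dist_eq] at h₁
    have := abs_sub_abs_le_abs_sub (φ x) (φ 0)
    linarith
  refine ⟨432 * ((|φ 0| + 1) / s ^ 2), by positivity, fun t x => ?_⟩
  -- Homogeneity of degree 2 preserves `|b d d|` under this rescaling, which carries the ball of
  -- radius `R` into the ball of radius `s` where `φ` is bounded.
  refine variation_le_of_control (ψ := fun R x => (R / s) ^ 2 * φ ((s / R) • x))
    (fun R hR x d => ?_) (fun R hR x hx => ?_) t x
  · have := mul_le_mul_of_nonneg_left (hφ ((s / R) • x) ((s / R) • d)) (sq_nonneg (R / s))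
    simp only [map_smul, smul_apply, smul_eq_mul, ← smul_sub, ← smul_add] at this
    have e' : (R / s) ^ 2 * |s / R * (s / R * b d d)| = |b d d| := by
      rw [← mul_assoc, abs_mul, abs_of_pos (by positivity : 0 < s / R * (s / R)), ← mul_assoc]
      field_simp
    linarith
  · rw [abs_mul, abs_of_pos (by positivity : 0 < (R / s) ^ 2)]
    have := hbd ((s / R) • x) (by
      rw [norm_smul, Real.norm_of_nonneg (by positivity)]
      calc s / R * ‖x‖ ≤ s / R * R := by gcongr
        _ = s := by field_simp)
    calc (R / s) ^ 2 * |φ ((s / R) • x)| ≤ (R / s) ^ 2 * (|φ 0| + 1) := by gcongr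
      _ = _ := by field_simp

end DyadicTree

/-! ### From the variation estimate to UMD, and property (dc) on products -/

section DeltaConvex

variable {X Y : Type*} [NormedAddCommGroup X] [NormedSpace ℝ X]
  [NormedAddCommGroup Y] [NormedSpace ℝ Y]

/-- Functionals need not attain their norm; losing a factor 2 keeps the test vector in `X` instead
of the bidual. -/
theorem exists_almost_norming (y : X →L[ℝ] ℝ) : ∃ g : X, ‖g‖ ≤ ‖y‖ ∧ 1 / 2 * ‖y‖ ^ 2 ≤ y g := by
  rcases (norm_nonneg y).eq_or_lt with h | h
  · exact ⟨0, by simp, by simp [← h]⟩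
  · obtain ⟨x, hx, hyx⟩ := y.exists_lt_apply_of_lt_opNorm (half_lt_self h)
    obtain ⟨u, hu, hyu⟩ : ∃ u : X, ‖u‖ < 1 ∧ ‖y‖ / 2 < y u := by
      rw [Real.norm_eq_abs] at hyx
      rcases abs_cases (y x) with ⟨ha, -⟩ | ⟨ha, -⟩ <;> rw [ha] at hyx
      · exact ⟨x, hx, hyx⟩
      · exact ⟨-x, by rwa [norm_neg], by rwa [map_neg]⟩
    refine ⟨‖y‖ • u, ?_, ?_⟩
    · rw [norm_smul, norm_norm]
      exact mul_le_of_le_one_right h.le hu.le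
    · rw [map_smul, smul_eq_mul]
      nlinarith

/-- A symmetric operator whose quadratic form is delta-convex is a UMD-operator. -/
theorem isUMDOperator_of_isDeltaConvex {b : X →L[ℝ] X →L[ℝ] ℝ} (hsymm : ∀ x y, b x y = b y x)
    (hb : IsDeltaConvex (fun x => b x x)) : IsUMDOperator b := by
  obtain ⟨K, hK, h⟩ := DyadicTree.exists_variation_le_of_isDeltaConvex hb
  have hvar : ∀ {n : ℕ} {f : Fin (n + 1) → (Fin n → ℤˣ) → X}, IsWalshPaleyMartingale f →
      cubeExpectation (fun ω => ∑ k : Fin n,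
        |b (f k.succ ω - f k.castSucc ω) (f k.succ ω - f k.castSucc ω)|) ≤
      K * cubeExpectation (fun ω => ‖f (Fin.last n) ω‖ ^ 2) := fun {n f} hf => by
    obtain ⟨x, hx⟩ := hf.exists_initial
    obtain ⟨t, e, v⟩ := DyadicTree.exists_of_martingale hf hx
    rw [e fun x => ‖x‖ ^ 2, v (fun d => b d d) fun d => by simp]
    exact h t x
  refine ⟨16 * K ^ 2, by positivity, fun n f hf ε => ?_⟩
  let y : (Fin n → ℤˣ) → X →L[ℝ] ℝ :=
    fun ω => ∑ k : Fin n, ε k • b (f k.succ ω - f k.castSucc ω)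
  -- Duality: `G` tests the transform pointwise and is the last term of a martingale `g`; by
  -- orthogonality only the pairings of differences of equal index survive.
  choose G hG₁ hG₂ using fun ω => exists_almost_norming (y ω)
  obtain ⟨g, hg, hgG⟩ := IsWalshPaleyMartingale.exists_last_eq n G
  obtain ⟨u, hu⟩ := hg.exists_initial
  have hpair := IsWalshPaleyMartingale.expectation_pairing b hf hg ε 0 hu
  simp only [zero_add, zero_apply, hgG] at hpair
  -- Polarisation costs `1 / (4 * c) = K`. The resulting coefficient of `𝔼 ‖y‖²` is then 1/4, which
  -- is absorbed into the 1/2 on the left and leaves the constant `16 * K ^ 2`.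
  set c : ℝ := 1 / (4 * K) with hc
  have hc₀ : 0 < c := by positivity
  have hpol : ∀ ω, ∑ k : Fin n,
      (ε k • b (f k.succ ω - f k.castSucc ω)) (g k.succ ω - g k.castSucc ω) ≤
      K * ∑ k : Fin n, |b ((f k.succ ω + c • g k.succ ω) - (f k.castSucc ω + c • g k.castSucc ω))
        ((f k.succ ω + c • g k.succ ω) - (f k.castSucc ω + c • g k.castSucc ω))| +
      K * ∑ k : Fin n, |b ((f k.succ ω + (-c) • g k.succ ω) -
        (f k.castSucc ω + (-c) • g k.castSucc ω))
        ((f k.succ ω + (-c) • g k.succ ω) - (f k.castSucc ω + (-c) • g k.castSucc ω))| := by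
    intro ω
    rw [← mul_add, ← Finset.sum_add_distrib, Finset.mul_sum]
    refine Finset.sum_le_sum fun k _ => ?_
    rw [show (f k.succ ω + c • g k.succ ω) - (f k.castSucc ω + c • g k.castSucc ω) =
      (f k.succ ω - f k.castSucc ω) + c • (g k.succ ω - g k.castSucc ω) by module,
      show (f k.succ ω + (-c) • g k.succ ω) - (f k.castSucc ω + (-c) • g k.castSucc ω) =
      (f k.succ ω - f k.castSucc ω) - c • (g k.succ ω - g k.castSucc ω) by module]
    generalize f k.succ ω - f k.castSucc ω = d
    generalize g k.succ ω - g k.castSucc ω = e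
    have hpolar : K * (b (d + c • e) (d + c • e) - b (d - c • e) (d - c • e)) = b d e := by
      simp only [map_add, map_sub, map_smul, add_apply, sub_apply, smul_apply, smul_eq_mul,
        hsymm e d, hc]
      field_simp
      ring
    have h₁ := neg_abs_le (b (d + c • e) (d + c • e))
    have h₂ := le_abs_self (b (d + c • e) (d + c • e))
    have h₃ := neg_abs_le (b (d - c • e) (d - c • e))
    have h₄ := le_abs_self (b (d - c • e) (d - c • e))
    rcases Int.units_eq_one_or (ε k) with hε | hε
    · rw [hε, one_smul, ← hpolar]
      gcongr
      linarith
    · rw [hε, Units.neg_smul, one_smul, neg_apply, ← hpolar, ← mul_neg]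
      gcongr
      linarith
  have h₁ := cubeExpectation_mono hpol
  rw [cubeExpectation_add, cubeExpectation_const_mul, cubeExpectation_const_mul, ← hpair] at h₁
  have h₂ := hvar (hf.add_smul hg c)
  have h₃ := hvar (hf.add_smul hg (-c))
  have h₄ : cubeExpectation (fun ω => ‖f (Fin.last n) ω + c • g (Fin.last n) ω‖ ^ 2) +
      cubeExpectation (fun ω => ‖f (Fin.last n) ω + (-c) • g (Fin.last n) ω‖ ^ 2) ≤
      4 * cubeExpectation (fun ω => ‖f (Fin.last n) ω‖ ^ 2) +
        4 * c ^ 2 * cubeExpectation (fun ω => ‖y ω‖ ^ 2) := by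
    rw [← cubeExpectation_add, ← cubeExpectation_const_mul, ← cubeExpectation_const_mul,
      ← cubeExpectation_add]
    refine cubeExpectation_mono fun ω => ?_
    rw [hgG]
    have hn : ‖c • G ω‖ ≤ c * ‖y ω‖ := by
      rw [norm_smul, Real.norm_of_nonneg hc₀.le]
      exact mul_le_mul_of_nonneg_left (hG₁ ω) hc₀.le
    have a₁ : ‖f (Fin.last n) ω + c • G ω‖ ≤ ‖f (Fin.last n) ω‖ + c * ‖y ω‖ :=
      (norm_add_le _ _).trans (by linarith)
    have a₂ : ‖f (Fin.last n) ω + (-c) • G ω‖ ≤ ‖f (Fin.last n) ω‖ + c * ‖y ω‖ := by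
      refine (norm_add_le _ _).trans ?_
      rw [neg_smul, norm_neg]
      linarith
    have b₁ := pow_le_pow_left₀ (norm_nonneg _) a₁ 2
    have b₂ := pow_le_pow_left₀ (norm_nonneg _) a₂ 2
    nlinarith [sq_nonneg (‖f (Fin.last n) ω‖ - c * ‖y ω‖)]
  have h₅ := cubeExpectation_mono hG₂
  rw [cubeExpectation_const_mul] at h₅
  change cubeExpectation (fun ω => ‖y ω‖ ^ 2) ≤ _
  have h₆ : 1 / 2 * cubeExpectation (fun ω => ‖y ω‖ ^ 2) ≤
      K * (K * (4 * cubeExpectation (fun ω => ‖f (Fin.last n) ω‖ ^ 2) +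
        4 * c ^ 2 * cubeExpectation (fun ω => ‖y ω‖ ^ 2))) := by
    refine (h₅.trans h₁).trans ?_
    rw [← mul_add]
    gcongr
    refine (add_le_add h₂ h₃).trans ?_
    rw [← mul_add]
    gcongr
  have h₇ : K * K * (4 * c ^ 2) = 1 / 4 := by
    rw [hc]
    field_simp
  rw [mul_add, mul_add, ← mul_assoc, ← mul_assoc, ← mul_assoc K K (4 * c ^ 2 * _),
    ← mul_assoc (K * K), h₇] at h₆
  linarith

theorem IsDeltaConvex.comp {q : Y → ℝ} (hq : IsDeltaConvex q) (L : X →L[ℝ] Y) :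
    IsDeltaConvex (fun x => q (L x)) := by
  obtain ⟨g, h, hg, hh, cg, ch, e⟩ := hq
  exact ⟨_, _, hg.comp L.continuous, hh.comp L.continuous,
    by simpa using cg.comp_linearMap L.toLinearMap, by simpa using ch.comp_linearMap L.toLinearMap,
    fun x => e _⟩

theorem IsDeltaConvex.add {p q : X → ℝ} (hp : IsDeltaConvex p) (hq : IsDeltaConvex q) :
    IsDeltaConvex (fun x => p x + q x) := by
  obtain ⟨g, h, hg, hh, cg, ch, e⟩ := hp
  obtain ⟨g', h', hg', hh', cg', ch', e'⟩ := hq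
  exact ⟨_, _, hg.add hg', hh.add hh', cg.add cg', ch.add ch', fun x => by
    simp only [e, e', Pi.add_apply]; ring⟩

theorem PropertyDC.of_leftInverse (h : PropertyDC Y) (i : X →L[ℝ] Y) (p : Y →L[ℝ] X)
    (hpi : ∀ x, p (i x) = x) : PropertyDC X := fun q hq => by
  have := (h _ (hq.comp p)).comp i
  simpa only [hpi] using this

theorem propertyDC_of_umd (h : ∀ T : X →L[ℝ] (X →L[ℝ] ℝ), IsUMDOperator T) :
    PropertyDC X := fun q ⟨b, hb⟩ => by
  rw [funext hb]
  exact (h b).isDeltaConvex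

/-- If the form `(x, y) ↦ T x y` is delta-convex, then `T` is a UMD-operator. -/
theorem IsUMDOperator.of_isDeltaConvex {T : X →L[ℝ] Y →L[ℝ] ℝ}
    (h : IsDeltaConvex (fun z : X × Y => T z.1 z.2)) : IsUMDOperator T := by
  obtain ⟨s, hs, e⟩ := (isContQuadForm_mixed T).exists_symm
  rw [funext e] at h
  -- `T` is twice the off-diagonal block of the symmetric operator `s` on the product, and
  -- compositions with bounded operators preserve UMD.
  have hU := (isUMDOperator_of_isDeltaConvex hs h).comp
    ((2 : ℝ) • (ContinuousLinearMap.compL ℝ Y (X × Y) ℝ).flip (.inr ℝ X Y)) (.inl ℝ X Y)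
  convert hU
  ext x y
  have e₁ := e (x, y)
  have e₂ := e (x, 0)
  have e₃ := e (0, y)
  rw [show (x, y) = (x, 0) + (0, y) by simp] at e₁
  simp only [map_add, add_apply, hs (0, y) (x, 0), Prod.fst_add, Prod.snd_add, add_zero, zero_add,
    map_zero, zero_apply] at e₁ e₂ e₃
  simp
  linarith

theorem propertyDC_prod_iff : PropertyDC (X × Y) ↔
    (PropertyDC X ∧ PropertyDC Y ∧ ∀ T : X →L[ℝ] (Y →L[ℝ] ℝ), IsUMDOperator T) := by
  constructor
  · intro h
    exact ⟨h.of_leftInverse (.inl ℝ X Y) (.fst ℝ X Y) fun x => by simp,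
      h.of_leftInverse (.inr ℝ X Y) (.snd ℝ X Y) fun x => by simp,
      fun T => .of_isDeltaConvex (h _ (isContQuadForm_mixed T))⟩
  · rintro ⟨h₁, h₂, h⟩ q hq
    obtain ⟨T, hT⟩ := hq.exists_prod_decomp
    rw [funext hT]
    refine .add (.add ?_ ?_) ?_
    · exact (h₁ _ (hq.comp (.inl ℝ X Y))).comp (.fst ℝ X Y)
    · exact (h₂ _ (hq.comp (.inr ℝ X Y))).comp (.snd ℝ X Y)
    · exact ((h T).comp ((ContinuousLinearMap.compL ℝ (X × Y) Y ℝ).flip (.snd ℝ X Y))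
        (.fst ℝ X Y)).isDeltaConvex

end DeltaConvex

theorem corollary3p6
    (X₁ : Type*) [NormedAddCommGroup X₁] [NormedSpace ℝ X₁] [CompleteSpace X₁]
    (X₂ : Type*) [NormedAddCommGroup X₂] [NormedSpace ℝ X₂] [CompleteSpace X₂]
    (X : Type*) [NormedAddCommGroup X] [NormedSpace ℝ X] [CompleteSpace X] :
    (PropertyD (X₁ × X₂) ↔
      (PropertyD X₁ ∧ PropertyD X₂ ∧
        ∀ T : X₁ →L[ℝ] (X₂ →L[ℝ] ℝ), FactorsThroughHilbert T)) ∧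
    (PropertyDC (X₁ × X₂) ↔
      (PropertyDC X₁ ∧ PropertyDC X₂ ∧
        ∀ T : X₁ →L[ℝ] (X₂ →L[ℝ] ℝ), IsUMDOperator T)) ∧
    (Nonempty (X ≃L[ℝ] X × X) →
      (PropertyD X ↔ ∀ T : X →L[ℝ] (X →L[ℝ] ℝ), FactorsThroughHilbert T) ∧
      (PropertyDC X ↔ ∀ T : X →L[ℝ] (X →L[ℝ] ℝ), IsUMDOperator T)) := by
  -- The isomorphism serves only the forward implications, where it transfers the property of `X` to
  -- its square.
  refine ⟨propertyD_prod_iff, propertyDC_prod_iff, fun ⟨e⟩ => ⟨⟨fun h => ?_, ?_⟩, ⟨fun h => ?_, ?_⟩⟩⟩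
  · exact (propertyD_prod_iff.1 (h.of_leftInverse (X := X × X) e.symm.toContinuousLinearMap
      e.toContinuousLinearMap fun x => by simp)).2.2
  · exact propertyD_of_factors
  · exact (propertyDC_prod_iff.1 (h.of_leftInverse (X := X × X) e.symm.toContinuousLinearMap
      e.toContinuousLinearMap fun x => by simp)).2.2
  · exact propertyDC_of_umd
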